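/- A depth-$d$ 1D-QAC circuit acts on finitely many qubits arranged on a line and has the form $C = L_d M_d \cdots L_1 M_1 L_0$, where each $L_k$ is a layer of arbitrary single-qubit unitaries and each $M_k$ is a layer of generalized CZ gates with pairwise disjoint supports, every support being an interval of consecutive qubits. (The generalized CZ gate with support $T$ multiplies a computational basis state by $-1$ if all qubits of $T$ are $1$, and fixes it otherwise.) Such a circuit has input size $n$ if $n$ of its qubits, at arbitrary positions on the line, are designated as input qubits; the remaining qubits, of which there may be any finite number, are ancillas. On input $x \in \{0,1\}^n$ the input qubits are initialized to $|x\rangle$ and the ancillas to an arbitrary fixed joint state $|a\rangle$ independent of $x$; after $C$ is applied, one designated qubit is measured in the computational basis, and $g_C(x) \in \{0,1\}$ denotes the random outcome. Let $\mathrm{PARITY}_n(x) = x_1 \oplus \cdots \oplus x_n$. **Theorem.** Let $n, d \ge 1$ be integers, and let $C$ be a depth-$d$ 1D-QAC circuit with input size $n$. Then, for $x$ uniformly random in $\{0,1\}^n$, $$\Pr_{x, C}\left[g_C(x) = \mathrm{PARITY}_n(x)\right] \le \frac12 + 4\sqrt2\, d \cdot 2^{-n^{1/d}/6}.$$ In particular,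 every 1D-QAC circuit that computes $\mathrm{PARITY}_n$ with average-case success probability at least $2/3$ has depth $\Omega(\log n / \log\log n)$: there are constants $c > 0$ and $n_0$ such that, for all $n \ge n_0$, every 1D-QAC circuit $C$ with input size $n$ and $\Pr_{x,C}[g_C(x) = \mathrm{PARITY}_n(x)] \ge 2/3$ has depth at least $c \log n / \log\log n$. -/

import Mathlib

open scoped BigOperators Matrix

/-- Computational basis labels of `N` qubits on a line; `true` is the basis value `1`. -/
abbrev QBits (N : ℕ) : Type := Fin N → Bool

/-- A layer of single-qubit unitaries on a line of `N` qubits: one `2 × 2` unitary per qubit. -/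
abbrev SingleLayer (N : ℕ) : Type := Fin N → Matrix.unitaryGroup Bool ℂ

/-- The tensor product of the single-qubit unitaries of a layer, as a `2^N × 2^N` matrix. -/
noncomputable def SingleLayer.toMatrix {N : ℕ} (L : SingleLayer N) :
    Matrix (QBits N) (QBits N) ℂ :=
  Matrix.of fun b c => ∏ q : Fin N, (L q : Matrix Bool Bool ℂ) (b q) (c q)

/-- A layer of generalized CZ gates on a line of `N` qubits. A gate is given by its support, which
has to be a nonempty interval of consecutive qubits; the gates of a layer have pairwise disjoint
supports. A layer may have any number of gates, of any sizes. -/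
structure CZLayer (N : ℕ) where
  gates : Finset (Finset (Fin N))
  contiguous : ∀ T ∈ gates, ∃ a b : Fin N, a ≤ b ∧ T = Finset.Icc a b
  disjoint : (gates : Set (Finset (Fin N))).PairwiseDisjoint id

/-- The eigenvalue of the CZ gate with support `T` on the basis vector `b`: it is `-1` if all
qubits of `T` have the value `1`, and `1` otherwise. -/
def czPhase {N : ℕ} (T : Finset (Fin N)) (b : QBits N) : ℂ :=
  if ∀ q ∈ T, b q = true then -1 else 1

/-- The product of the (commuting, diagonal) CZ gates of a layer, as a `2^N × 2^N` matrix. -/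
noncomputable def CZLayer.toMatrix {N : ℕ} (M : CZLayer N) :
    Matrix (QBits N) (QBits N) ℂ :=
  Matrix.diagonal fun b => ∏ T ∈ M.gates, czPhase T b

/-- One-dimensional QAC circuits `L_d M_d ⋯ L_1 M_1 L_0` on a line of `N` qubits, indexed by the
depth `d`, which is the number of CZ layers. -/
inductive OneDQAC (N : ℕ) : ℕ → Type
  | base (L : SingleLayer N) : OneDQAC N 0
  | layer {d : ℕ} (C : OneDQAC N d) (M : CZLayer N) (L : SingleLayer N) : OneDQAC N (d + 1)

/-- The unitary implemented by a circuit. -/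
noncomputable def OneDQAC.toMatrix {N : ℕ} :
    {d : ℕ} → OneDQAC N d → Matrix (QBits N) (QBits N) ℂ
  | _, .base L => L.toMatrix
  | _, .layer C M L => L.toMatrix * M.toMatrix * C.toMatrix

/-- A depth-`d` one-dimensional QAC circuit on a line of `N` qubits that is used to compute a
Boolean function of `n` bits: `input i` is the position of the `i`-th input qubit (any distinct
positions), all the other qubits are ancillas, `ancilla` is their joint initial state (any unit
vector), and `output` is the position of the qubit that is measured. -/
structure OneDQACWithInput (n N d : ℕ) where
  circuit : OneDQAC N d
  input : Fin n ↪ Fin N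
  ancilla : EuclideanSpace ℂ ({q : Fin N // q ∉ Set.range input} → Bool)
  ancilla_norm : ‖ancilla‖ = 1
  output : Fin N

namespace OneDQACWithInput

variable {n N d : ℕ}

/-- The initial state `|x⟩ ⊗ |a⟩`, with `|x⟩` on the input qubits and `|a⟩` on the ancillas. -/
noncomputable def initialState (C : OneDQACWithInput n N d) (x : Fin n → Bool) : QBits N → ℂ :=
  fun b => if ∀ i, b (C.input i) = x i then C.ancilla (fun q => b q.1) else 0

/-- The final state of the circuit on the input `x`. -/
noncomputable def finalState (C : OneDQACWithInput n N d) (x : Fin n → Bool) : QBits N → ℂ :=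
  C.circuit.toMatrix *ᵥ C.initialState x

/-- The probability that measuring the output qubit of the final state on the input `x` in the
computational basis gives the outcome `v`. -/
noncomputable def outcomeProb (C : OneDQACWithInput n N d) (x : Fin n → Bool) (v : Bool) : ℝ :=
  ∑ b : QBits N, if b C.output = v then ‖C.finalState x b‖ ^ 2 else 0

/-- The probability, over a uniformly random `x ∈ {0,1}ⁿ` and the measurement, that the measured
outcome is `f x`. -/
noncomputable def successProb (C : OneDQACWithInput n N d) (f : (Fin n → Bool) → Bool) : ℝ :=
  (∑ x : Fin n → Bool, C.outcomeProb x (f x)) / 2 ^ n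

end OneDQACWithInput

/-- The parity function: `1` exactly when an odd number of the bits are `1`. -/
def parityFn (n : ℕ) (x : Fin n → Bool) : Bool :=
  decide (Odd (Finset.univ.filter fun i => x i = true).card)

/-! A gate can matter only when all its qubits are 1. Suppose a gate `T` contains the forward light
cones of `k` inputs. The state just before it is fixed by a projection, acting on `T` alone, that
pins those `k` input bits; for random `x` it is therefore all 1 on `T` with probability at most `2 ^
(-k)`. In each layer the gates of this kind claim disjoint sets of at least `k` inputs, so there are
at most `n / k` of them, and deleting them perturbs the final states little
(`OneDQACWithInput.norm_sub_trunc_le`). The deletion runs layer by layer, with light cones taken in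
the circuit already truncated.

After truncation with `k = m + 1`, every remaining gate contains at most `m` light cones. Gates
being disjoint intervals, at most one gate straddles a given cut of the line, and so the number of
inputs whose cone crosses a cut grows by a factor of about 3 per layer
(`OneDQAC.card_cross_trunc_le`). If `m * (3 ^ d - 1) + 1 < n`, the output lies outside the cone of
some input. The truncated circuit then cannot see that input and guesses parity with probability
exactly `1 / 2`. The theorem follows by taking `m` of order `n / 3 ^ d`. -/

variable {N : ℕ}

/-! ### Tensor products and single-qubit operators -/

/-- The tensor product of one `2 × 2` matrix per qubit. -/
noncomputable def tensorMat (m : Fin N → Matrix Bool Bool ℂ) : Matrix (QBits N) (QBits N) ℂ :=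
  Matrix.of fun b c => ∏ q, m q (b q) (c q)

theorem tensorMat_mul (m m' : Fin N → Matrix Bool Bool ℂ) :
    tensorMat m * tensorMat m' = tensorMat (m * m') := by
  ext b c
  simp only [tensorMat, Matrix.mul_apply, Matrix.of_apply, Pi.mul_apply, ← Finset.prod_mul_distrib]
  rw [Finset.prod_univ_sum, Fintype.piFinset_univ]

theorem tensorMat_one : tensorMat (1 : Fin N → Matrix Bool Bool ℂ) = 1 := by
  ext b c
  simp only [tensorMat, Matrix.of_apply, Pi.one_apply, Matrix.one_apply]
  by_cases h : b = c
  · simp [h]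
  · obtain ⟨q, hq⟩ := Function.ne_iff.mp h
    rw [if_neg h]
    exact Finset.prod_eq_zero (Finset.mem_univ q) (by simp [hq])

theorem tensorMat_conjTranspose (m : Fin N → Matrix Bool Bool ℂ) :
    (tensorMat m)ᴴ = tensorMat fun q => (m q)ᴴ := by
  ext b c
  simp [tensorMat, Matrix.conjTranspose_apply]

theorem SingleLayer.toMatrix_eq (L : SingleLayer N) :
    L.toMatrix = tensorMat fun q => (L q : Matrix Bool Bool ℂ) := rfl

theorem SingleLayer.toMatrix_mem_unitaryGroup (L : SingleLayer N) :
    L.toMatrix ∈ Matrix.unitaryGroup (QBits N) ℂ := by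
  rw [Matrix.mem_unitaryGroup_iff, Matrix.star_eq_conjTranspose, L.toMatrix_eq,
    tensorMat_conjTranspose, tensorMat_mul, ← tensorMat_one]
  congr 1
  funext q
  exact Matrix.mem_unitaryGroup_iff.mp (L q).2

/-- A matrix acting on the single qubit `q`. -/
noncomputable def siteOp (q : Fin N) (m : Matrix Bool Bool ℂ) : Matrix (QBits N) (QBits N) ℂ :=
  tensorMat (Function.update 1 q m)

theorem siteOp_apply (q : Fin N) (m : Matrix Bool Bool ℂ) (b c : QBits N) :
    siteOp q m b c = if ∀ r, r ≠ q → b r = c r then m (b q) (c q) else 0 := by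
  have hsplit : siteOp q m b c
      = m (b q) (c q) * ∏ r ∈ Finset.univ.erase q, (1 : Matrix Bool Bool ℂ) (b r) (c r) := by
    rw [siteOp, tensorMat, Matrix.of_apply, ← Finset.mul_prod_erase _ _ (Finset.mem_univ q)]
    congr 1
    · simp
    · refine Finset.prod_congr rfl fun r hr => ?_
      rw [Function.update_of_ne (Finset.ne_of_mem_erase hr)]
      rfl
  rw [hsplit]
  split_ifs with h
  · rw [Finset.prod_eq_one, mul_one]
    intro r hr
    rw [h r (Finset.ne_of_mem_erase hr), Matrix.one_apply_eq]
  · push Not at h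
    obtain ⟨r, hr, hbc⟩ := h
    rw [Finset.prod_eq_zero (Finset.mem_erase.mpr ⟨hr, Finset.mem_univ r⟩), mul_zero]
    simp [hbc]

theorem siteOp_single_mul {α : Type*} (q : Fin N) (u v : Bool) (A : Matrix (QBits N) α ℂ)
    (b : QBits N) (c : α) :
    (siteOp q (Matrix.single u v 1) * A) b c
      = if b q = u then A (Function.update b q v) c else 0 := by
  rw [Matrix.mul_apply, Finset.sum_eq_single (Function.update b q v)]
  · rw [siteOp_apply, if_pos fun r hr => (Function.update_of_ne hr _ _).symm]
    simp [Matrix.single_apply, eq_comm]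
  · intro c' _ hc'
    rw [siteOp_apply]
    split_ifs with h
    · have : c' q ≠ v := by
        rintro rfl
        refine hc' (funext fun r => ?_)
        by_cases hr : r = q
        · subst hr; simp
        · rw [Function.update_of_ne hr, h r hr]
      simp [this.symm]
    · simp
  · simp

theorem mul_siteOp_single (q : Fin N) (u v : Bool) (A : Matrix (QBits N) (QBits N) ℂ)
    (b c : QBits N) :
    (A * siteOp q (Matrix.single u v 1)) b c
      = if c q = v then A b (Function.update c q u) else 0 := by
  rw [Matrix.mul_apply, Finset.sum_eq_single (Function.update c q u)]
  · rw [siteOp_apply, if_pos fun r hr => Function.update_of_ne hr _ _]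
    simp [Matrix.single_apply, eq_comm]
  · intro c' _ hc'
    rw [siteOp_apply]
    split_ifs with h
    · have : c' q ≠ u := by
        rintro rfl
        refine hc' (funext fun r => ?_)
        by_cases hr : r = q
        · subst hr; simp
        · rw [Function.update_of_ne hr, h r hr]
      simp [this.symm]
    · simp
  · simp

/-! ### Supports of operators and forward light cones -/

/-- The matrix `A` acts as the identity outside the set `S` of qubits. -/
def SuppOn (S : Set (Fin N)) (A : Matrix (QBits N) (QBits N) ℂ) : Prop :=
  ∀ q, q ∉ S → ∀ m, Commute (siteOp q m) A

theorem SuppOn.mono {S S' : Set (Fin N)} {A : Matrix (QBits N) (QBits N) ℂ} (h : SuppOn S A)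
    (hS : S ⊆ S') : SuppOn S' A :=
  fun q hq m => h q (fun hq' => hq (hS hq')) m

/-- This is commutation with the matrix unit `|u⟩⟨v|` at `q`, read entry by entry. Suitable `u`, `v`
give the two facts used later: `A` is diagonal in the qubit `q`, and its diagonal entries do not
depend on that qubit. -/
theorem SuppOn.apply_update {S : Set (Fin N)} {A : Matrix (QBits N) (QBits N) ℂ} (h : SuppOn S A)
    {q : Fin N} (hq : q ∉ S) (b c : QBits N) (u v : Bool) :
    (if b q = u then A (Function.update b q v) c else 0)
      = if c q = v then A b (Function.update c q u) else 0 := by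
  rw [← siteOp_single_mul, ← mul_siteOp_single, (h q hq _).eq]

theorem SuppOn.apply_eq_zero {S : Set (Fin N)} {A : Matrix (QBits N) (QBits N) ℂ}
    (h : SuppOn S A) {q : Fin N} (hq : q ∉ S) {b c : QBits N} (hbc : b q ≠ c q) : A b c = 0 := by
  have := h.apply_update hq b c (b q) (b q)
  rwa [if_pos rfl, if_neg hbc.symm, Function.update_eq_self] at this

theorem SuppOn.apply_diag_update {S : Set (Fin N)} {A : Matrix (QBits N) (QBits N) ℂ}
    (h : SuppOn S A) {q : Fin N} (hq : q ∉ S) (b : QBits N) (v : Bool) :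
    A (Function.update b q v) (Function.update b q v) = A b b := by
  have := h.apply_update hq b (Function.update b q v) (b q) v
  simpa using this

theorem SuppOn.apply_diag_congr {S : Set (Fin N)} {A : Matrix (QBits N) (QBits N) ℂ}
    (h : SuppOn S A) {b c : QBits N} (hbc : ∀ q ∈ S, b q = c q) : A b b = A c c := by
  have key : ∀ F : Finset (Fin N), (∀ q ∈ F, b q ≠ c q) →
      A (F.piecewise b c) (F.piecewise b c) = A c c := by
    intro F
    induction F using Finset.induction_on with
    | empty => simp
    | insert q F _ ih =>
      intro hF
      have hq : q ∉ S := fun hq => hF q (Finset.mem_insert_self q F) (hbc q hq)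
      rw [Finset.piecewise_insert, h.apply_diag_update hq]
      exact ih fun r hr => hF r (Finset.mem_insert_of_mem hr)
  have hb : (Finset.univ.filter fun q => b q ≠ c q).piecewise b c = b := by
    funext q
    by_cases hq : b q = c q <;> simp [Finset.piecewise, hq]
  rw [← key _ (fun q hq => (Finset.mem_filter.mp hq).2), hb]

theorem SuppOn.commute_diagonal {S : Set (Fin N)} {A : Matrix (QBits N) (QBits N) ℂ}
    (h : SuppOn S A) {f : QBits N → ℂ} (hf : ∀ b c, (∀ q, q ∉ S → b q = c q) → f b = f c) :
    Commute (Matrix.diagonal f) A := by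
  ext b c
  rw [Matrix.diagonal_mul, Matrix.mul_diagonal]
  by_cases hbc : ∀ q, q ∉ S → b q = c q
  · rw [hf b c hbc, mul_comm]
  · push Not at hbc
    obtain ⟨q, hq, hne⟩ := hbc
    simp [h.apply_eq_zero hq hne]

theorem suppOn_diagonal {S : Set (Fin N)} {f : QBits N → ℂ}
    (hf : ∀ b c, (∀ q ∈ S, b q = c q) → f b = f c) : SuppOn S (Matrix.diagonal f) := by
  intro q hq m
  ext b c
  rw [Matrix.diagonal_mul, Matrix.mul_diagonal, siteOp_apply]
  split_ifs with h
  · rw [hf b c fun r hr => h r (ne_of_mem_of_not_mem hr hq), mul_comm]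
  · simp

theorem suppOn_siteOp (q : Fin N) (m : Matrix Bool Bool ℂ) : SuppOn {q} (siteOp q m) := by
  intro r hr m'
  have hr : r ≠ q := hr
  rw [Commute, SemiconjBy, siteOp, siteOp, tensorMat_mul, tensorMat_mul]
  congr 1
  funext s
  by_cases h1 : s = r
  · subst h1; simp [hr]
  · by_cases h2 : s = q
    · subst h2; simp [h1]
    · simp [h1, h2]

theorem conjTranspose_siteOp_mul (L : SingleLayer N) (q : Fin N) (m : Matrix Bool Bool ℂ) :
    ∃ m', L.toMatrixᴴ * siteOp q m * L.toMatrix = siteOp q m' := by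
  refine ⟨(L q : Matrix Bool Bool ℂ)ᴴ * m * L q, ?_⟩
  rw [L.toMatrix_eq, tensorMat_conjTranspose, siteOp, siteOp, tensorMat_mul, tensorMat_mul]
  congr 1
  funext r
  by_cases h : r = q
  · subst h; simp
  · simp only [Pi.mul_apply, Function.update_of_ne h, Pi.one_apply, mul_one]
    exact Matrix.mem_unitaryGroup_iff'.mp (L r).2

/-- Moving the layer to the other side turns a one-qubit operator at `q` into another one at `q`,
which still commutes with `A`. -/
theorem SuppOn.conj_singleLayer {S : Set (Fin N)} {A : Matrix (QBits N) (QBits N) ℂ}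
    (h : SuppOn S A) (L : SingleLayer N) : SuppOn S (L.toMatrix * A * L.toMatrixᴴ) := by
  intro q hq m
  obtain ⟨m', hm'⟩ := conjTranspose_siteOp_mul L q m
  have hu : L.toMatrix * L.toMatrixᴴ = 1 :=
    Matrix.mem_unitaryGroup_iff.mp L.toMatrix_mem_unitaryGroup
  have hc := (h q hq m').eq
  rw [← hm'] at hc
  calc siteOp q m * (L.toMatrix * A * L.toMatrixᴴ)
      = (L.toMatrix * L.toMatrixᴴ) * siteOp q m * (L.toMatrix * A * L.toMatrixᴴ) := by
        rw [hu, one_mul]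
    _ = L.toMatrix * (L.toMatrixᴴ * siteOp q m * L.toMatrix * A) * L.toMatrixᴴ := by
        simp only [Matrix.mul_assoc]
    _ = L.toMatrix * (A * (L.toMatrixᴴ * siteOp q m * L.toMatrix)) * L.toMatrixᴴ := by rw [hc]
    _ = L.toMatrix * A * L.toMatrixᴴ * siteOp q m * (L.toMatrix * L.toMatrixᴴ) := by
        simp only [Matrix.mul_assoc]
    _ = L.toMatrix * A * L.toMatrixᴴ * siteOp q m := by rw [hu, mul_one]

theorem czPhase_mul_star (T : Finset (Fin N)) (b : QBits N) :
    czPhase T b * star (czPhase T b) = 1 := by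
  unfold czPhase
  split_ifs <;> simp

theorem diagonal_czPhase_mem_unitaryGroup (G : Finset (Finset (Fin N))) :
    Matrix.diagonal (fun b : QBits N => ∏ T ∈ G, czPhase T b)
      ∈ Matrix.unitaryGroup (QBits N) ℂ := by
  rw [Matrix.mem_unitaryGroup_iff, Matrix.star_eq_conjTranspose, Matrix.diagonal_conjTranspose,
    Matrix.diagonal_mul_diagonal, ← Matrix.diagonal_one]
  congr 1
  funext b
  rw [Pi.star_apply, star_prod, ← Finset.prod_mul_distrib]
  exact Finset.prod_eq_one fun T _ => czPhase_mul_star T b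

theorem czPhase_congr {T : Finset (Fin N)} {b c : QBits N} (h : ∀ q ∈ T, b q = c q) :
    czPhase T b = czPhase T c := by
  unfold czPhase
  congr 1
  exact propext (forall₂_congr fun q hq => by rw [h q hq])

/-- The qubits of `S` together with those of the gates of `M` that meet `S`. -/
def CZLayer.spread (M : CZLayer N) (S : Set (Fin N)) : Set (Fin N) :=
  {q | q ∈ S ∨ ∃ T ∈ M.gates, q ∈ T ∧ ∃ r ∈ T, r ∈ S}

/-- Gates that miss `S` commute with `A` and cancel against their adjoints, so only gates meeting
`S` enlarge the support. -/
theorem SuppOn.conj_czLayer {S : Set (Fin N)} {A : Matrix (QBits N) (QBits N) ℂ}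
    (h : SuppOn S A) (M : CZLayer N) : SuppOn (M.spread S) (M.toMatrix * A * M.toMatrixᴴ) := by
  classical
  set D₁ := Matrix.diagonal fun b : QBits N =>
    ∏ T ∈ M.gates.filter (fun T => ∃ r ∈ T, r ∈ S), czPhase T b with hD₁
  set D₂ := Matrix.diagonal fun b : QBits N =>
    ∏ T ∈ M.gates.filter (fun T => ¬ ∃ r ∈ T, r ∈ S), czPhase T b with hD₂
  have hM : M.toMatrix = D₁ * D₂ := by
    rw [hD₁, hD₂, Matrix.diagonal_mul_diagonal, CZLayer.toMatrix]
    congr 1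
    funext b
    exact (Finset.prod_filter_mul_prod_filter_not _ _ _).symm
  have h2 : Commute D₂ A := by
    refine h.commute_diagonal fun b c hbc => Finset.prod_congr rfl fun T hT => ?_
    refine czPhase_congr fun q hq => hbc q fun hqS => (Finset.mem_filter.mp hT).2 ⟨q, hq, hqS⟩
  have hu2 : D₂ * D₂ᴴ = 1 :=
    Matrix.mem_unitaryGroup_iff.mp (diagonal_czPhase_mem_unitaryGroup _)
  have hconj : M.toMatrix * A * M.toMatrixᴴ = D₁ * A * D₁ᴴ := by
    rw [hM, Matrix.conjTranspose_mul]
    calc D₁ * D₂ * A * (D₂ᴴ * D₁ᴴ) = D₁ * (D₂ * A) * D₂ᴴ * D₁ᴴ := by simp only [Matrix.mul_assoc]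
      _ = D₁ * A * (D₂ * D₂ᴴ) * D₁ᴴ := by rw [h2.eq]; simp only [Matrix.mul_assoc]
      _ = D₁ * A * D₁ᴴ := by rw [hu2, mul_one]
  have hD : SuppOn (M.spread S) D₁ := by
    refine suppOn_diagonal fun b c hbc => Finset.prod_congr rfl fun T hT => ?_
    rw [Finset.mem_filter] at hT
    exact czPhase_congr fun q hq => hbc q (Or.inr ⟨T, hT.1, hq, hT.2⟩)
  have hDH : SuppOn (M.spread S) D₁ᴴ := by
    rw [hD₁, Matrix.diagonal_conjTranspose]
    refine suppOn_diagonal fun b c hbc => congrArg star (Finset.prod_congr rfl fun T hT => ?_)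
    rw [Finset.mem_filter] at hT
    exact czPhase_congr fun q hq => hbc q (Or.inr ⟨T, hT.1, hq, hT.2⟩)
  rw [hconj]
  intro q hq m
  exact ((hD q hq m).mul_right (h q (fun hqS => hq (Or.inl hqS)) m)).mul_right (hDH q hq m)

theorem OneDQAC.toMatrix_mem_unitaryGroup {d : ℕ} (C : OneDQAC N d) :
    C.toMatrix ∈ Matrix.unitaryGroup (QBits N) ℂ := by
  induction C with
  | base L => exact L.toMatrix_mem_unitaryGroup
  | layer C M L ih =>
    exact mul_mem (mul_mem L.toMatrix_mem_unitaryGroup (diagonal_czPhase_mem_unitaryGroup _)) ih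

/-- The forward light cone of a set of qubits. -/
def OneDQAC.cone : {d : ℕ} → OneDQAC N d → Set (Fin N) → Set (Fin N)
  | _, .base _, S => S
  | _, .layer C M _, S => M.spread (C.cone S)

theorem SuppOn.conj_circuit {S : Set (Fin N)} {A : Matrix (QBits N) (QBits N) ℂ}
    (h : SuppOn S A) {d : ℕ} (C : OneDQAC N d) :
    SuppOn (C.cone S) (C.toMatrix * A * C.toMatrixᴴ) := by
  induction C with
  | base L => exact h.conj_singleLayer L
  | layer C M L ih =>
    have := (ih.conj_czLayer M).conj_singleLayer L
    simpa only [OneDQAC.toMatrix, OneDQAC.cone, Matrix.conjTranspose_mul, Matrix.mul_assoc]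
      using this

theorem OneDQAC.subset_cone {d : ℕ} (C : OneDQAC N d) (S : Set (Fin N)) : S ⊆ C.cone S := by
  induction C with
  | base L => exact subset_rfl
  | layer C M L ih => exact fun q hq => Or.inl (ih hq)

theorem OneDQAC.mem_cone_iff {d : ℕ} (C : OneDQAC N d) (S : Set (Fin N)) (q : Fin N) :
    q ∈ C.cone S ↔ ∃ r ∈ S, q ∈ C.cone {r} := by
  induction C generalizing q with
  | base L => simp [OneDQAC.cone]
  | layer C M L ih =>
    simp only [OneDQAC.cone, CZLayer.spread, Set.mem_ofPred_eq, ih]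
    grind

/-! ### Probability that a gate containing many light cones acts -/

section Frobenius

open scoped Matrix.Norms.Frobenius ComplexOrder

variable {n N d : ℕ}

theorem frobenius_norm_sq {m n : Type*} [Fintype m] [Fintype n] (A : Matrix m n ℂ) :
    ‖A‖ ^ 2 = ∑ i, ∑ j, ‖A i j‖ ^ 2 := by
  rw [Matrix.frobenius_norm_def, ← Real.sqrt_eq_rpow, Real.sq_sqrt (by positivity)]
  simp

theorem sum_norm_sq_unitary_mul {m n : Type*} [Fintype m] [DecidableEq m] [Fintype n]
    {U : Matrix m m ℂ} (hU : U ∈ Matrix.unitaryGroup m ℂ) (A : Matrix m n ℂ) (j : n) :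
    ∑ i, ‖(U * A) i j‖ ^ 2 = ∑ i, ‖A i j‖ ^ 2 := by
  have key : ∀ B : Matrix m n ℂ, ((∑ i, ‖B i j‖ ^ 2 : ℝ) : ℂ) = (Bᴴ * B) j j := by
    intro B
    rw [Matrix.mul_apply, Complex.ofReal_sum]
    refine Finset.sum_congr rfl fun i _ => ?_
    rw [Matrix.conjTranspose_apply, Complex.ofReal_pow]
    exact (Complex.conj_mul' _).symm
  have h : (U * A)ᴴ * (U * A) = Aᴴ * A := by
    have hu : Uᴴ * U = 1 := Matrix.mem_unitaryGroup_iff'.mp hU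
    rw [Matrix.conjTranspose_mul, Matrix.mul_assoc, ← Matrix.mul_assoc Uᴴ, hu, Matrix.one_mul]
  have := key (U * A)
  rw [h, ← key A] at this
  exact_mod_cast this

theorem frobenius_norm_unitary_mul {m n : Type*} [Fintype m] [DecidableEq m] [Fintype n]
    {U : Matrix m m ℂ} (hU : U ∈ Matrix.unitaryGroup m ℂ) (A : Matrix m n ℂ) :
    ‖U * A‖ = ‖A‖ := by
  rw [← sq_eq_sq₀ (norm_nonneg _) (norm_nonneg _), frobenius_norm_sq, frobenius_norm_sq,
    Finset.sum_comm, Finset.sum_comm (f := fun i j => ‖A i j‖ ^ 2)]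
  exact Finset.sum_congr rfl fun j _ => sum_norm_sq_unitary_mul hU A j

/-- The matrix whose columns are the initial states. -/
noncomputable def OneDQACWithInput.initialMatrix (C : OneDQACWithInput n N d) :
    Matrix (QBits N) (Fin n → Bool) ℂ :=
  Matrix.of fun b x => C.initialState x b

theorem OneDQACWithInput.sum_norm_sq_initialState (C : OneDQACWithInput n N d)
    (x : Fin n → Bool) : ∑ b, ‖C.initialState x b‖ ^ 2 = 1 := by
  classical
  have hn : ∑ a, ‖C.ancilla a‖ ^ 2 = 1 := by
    rw [← EuclideanSpace.norm_sq_eq, C.ancilla_norm, one_pow]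
  have hs : ∀ b, ‖C.initialState x b‖ ^ 2
      = if ∀ i, b (C.input i) = x i then ‖C.ancilla fun q => b q.1‖ ^ 2 else 0 := by
    intro b
    unfold OneDQACWithInput.initialState
    split_ifs <;> simp
  rw [← hn, Finset.sum_congr rfl fun b _ => hs b, ← Finset.sum_filter]
  refine Finset.sum_bij' (fun b _ q => b q.1)
    (fun a _ q => if h : ∃ i, C.input i = q then x h.choose else a ⟨q, h⟩) ?_ ?_ ?_ ?_ ?_
  · simp
  · intro a _
    rw [Finset.mem_filter]
    refine ⟨Finset.mem_univ _, fun i => ?_⟩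
    have h : ∃ j, C.input j = C.input i := ⟨i, rfl⟩
    exact (dif_pos h).trans (congrArg x (C.input.injective h.choose_spec))
  · intro b hb
    funext q
    by_cases h : ∃ i, C.input i = q
    · refine (dif_pos h).trans ?_
      rw [← (Finset.mem_filter.mp hb).2, h.choose_spec]
    · exact dif_neg h
  · intro a _
    funext q
    exact dif_neg q.2
  · intro b _
    rfl

theorem OneDQACWithInput.norm_initialMatrix_sq (C : OneDQACWithInput n N d) :
    ‖C.initialMatrix‖ ^ 2 = 2 ^ n := by
  rw [frobenius_norm_sq, Finset.sum_comm]
  simp only [initialMatrix, Matrix.of_apply, C.sum_norm_sq_initialState]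
  simp

theorem card_filter_agree (S : Finset (Fin n)) (y : Fin n → Bool) :
    ((Finset.univ.filter fun x : Fin n → Bool => ∀ i ∈ S, y i = x i).card : ℝ)
      = 2 ^ n / 2 ^ S.card := by
  have h : (Finset.univ.filter fun x : Fin n → Bool => ∀ i ∈ S, y i = x i)
      = Fintype.piFinset fun i => if i ∈ S then {y i} else Finset.univ := by
    ext x
    simp only [Finset.mem_filter, Finset.mem_univ, true_and, Fintype.mem_piFinset]
    refine forall_congr' fun i => ?_
    by_cases hi : i ∈ S <;> simp [hi, eq_comm (a := y i)]
  rw [h, Fintype.card_piFinset]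
  have h2 : ∀ i, (if i ∈ S then ({y i} : Finset Bool) else Finset.univ).card
      = if i ∈ S then 1 else 2 := by
    intro i
    split_ifs <;> simp
  simp only [h2]
  rw [Finset.prod_ite]
  have h3 : (Finset.univ.filter fun i => i ∉ S) = Sᶜ := by ext; simp
  rw [Finset.prod_const_one, one_mul, Finset.prod_const, h3, Finset.card_compl, Fintype.card_fin,
    eq_div_iff (by positivity)]
  push_cast
  rw [← pow_add, Nat.sub_add_cancel]
  simpa using Finset.card_le_univ S

/-- If `Π` is a projection fixing the unit vector `ψ` and acts only on `T`, then `ψ` has all qubits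
of `T` equal to `1` with probability at most the corresponding diagonal entry of `Π`. -/
theorem sum_norm_sq_le_of_suppOn {T : Finset (Fin N)} {Q : Matrix (QBits N) (QBits N) ℂ}
    (hQ : SuppOn (T : Set (Fin N)) Q) (hH : Qᴴ = Q) (hQQ : Q * Q = Q) {ψ : QBits N → ℂ}
    (hψ : ∑ b, ‖ψ b‖ ^ 2 = 1) (hQψ : Q *ᵥ ψ = ψ) {c : ℝ} (hc : Q (fun _ => true) (fun _ => true) = c) :
    ∑ b : QBits N, (if ∀ q ∈ T, b q = true then ‖ψ b‖ ^ 2 else 0) ≤ c := by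
  set z : QBits N → ℂ := fun b => if ∀ q ∈ T, b q = true then ψ b else 0 with hz
  have hsq : ∀ w : QBits N → ℂ, star w ⬝ᵥ w = ((∑ b, ‖w b‖ ^ 2 : ℝ) : ℂ) := by
    intro w
    rw [dotProduct, Complex.ofReal_sum]
    refine Finset.sum_congr rfl fun b _ => ?_
    rw [Complex.ofReal_pow]
    exact Complex.conj_mul' _
  have hzψ : ∑ b : QBits N, (if ∀ q ∈ T, b q = true then ‖ψ b‖ ^ 2 else 0)
      = ∑ b, ‖z b‖ ^ 2 := by
    refine Finset.sum_congr rfl fun b _ => ?_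
    simp only [hz]
    split_ifs <;> simp
  rw [hzψ]
  set s := ∑ b, ‖z b‖ ^ 2 with hs
  have hadj : ∀ w : QBits N → ℂ, star (Q *ᵥ z) ⬝ᵥ w = star z ⬝ᵥ (Q *ᵥ w) := by
    intro w
    rw [Matrix.star_mulVec, hH, Matrix.dotProduct_mulVec]
  -- `z` is the part of `ψ` that is all 1 on `T`, and `s` its squared norm. Since `Q` is
  -- self-adjoint and fixes `ψ`, the vector `Q z` has inner product `s` with `ψ`.
  have h1 : star (Q *ᵥ z) ⬝ᵥ ψ = (s : ℂ) := by
    rw [hadj, hQψ, hs, ← hsq]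
    simp only [dotProduct]
    refine Finset.sum_congr rfl fun b _ => ?_
    simp only [hz, Pi.star_apply]
    split_ifs <;> simp
  -- As `Q` acts only on `T`, compressing it to the vectors that are all 1 on `T` gives the scalar
  -- `c`. With `h1`, Cauchy–Schwarz then yields `s ^ 2 ≤ c * s`.
  have h2 : ((∑ b, ‖(Q *ᵥ z) b‖ ^ 2 : ℝ) : ℂ) = ((c * s : ℝ) : ℂ) := by
    rw [← hsq, hadj, Matrix.mulVec_mulVec, hQQ, Complex.ofReal_mul, hs, ← hsq]
    simp only [dotProduct, Finset.mul_sum]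
    refine Finset.sum_congr rfl fun b _ => ?_
    by_cases hb : ∀ q ∈ T, b q = true
    · have : (Q *ᵥ z) b = c * z b := by
        rw [Matrix.mulVec, dotProduct, Finset.sum_eq_single b]
        · rw [← hc, hQ.apply_diag_congr (c := fun _ => true) hb]
        · intro b' _ hne
          by_cases hb' : ∀ q ∈ T, b' q = true
          · obtain ⟨q, hq⟩ := Function.ne_iff.mp hne
            have hqT : q ∉ (T : Set (Fin N)) := fun h => hq (by rw [hb q h, hb' q h])
            rw [hQ.apply_eq_zero hqT (Ne.symm hq), zero_mul]
          · simp only [hz, if_neg hb', mul_zero]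
        · simp
      rw [this]
      ring
    · have : z b = 0 := if_neg hb
      simp [this]
  have h2' : ∑ b, ‖(Q *ᵥ z) b‖ ^ 2 = c * s := by exact_mod_cast h2
  have h3 : s ≤ ∑ b, ‖(Q *ᵥ z) b‖ * ‖ψ b‖ := by
    have hs0 : 0 ≤ s := Finset.sum_nonneg fun b _ => by positivity
    calc s = ‖(s : ℂ)‖ := by rw [Complex.norm_real, Real.norm_of_nonneg hs0]
      _ ≤ ∑ b, ‖star ((Q *ᵥ z) b) * ψ b‖ := by
        rw [← h1]
        exact norm_sum_le _ _
      _ = _ := by simp only [norm_mul, norm_star]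
  have h4 : s ^ 2 ≤ c * s := by
    have hs0 : 0 ≤ s := Finset.sum_nonneg fun b _ => by positivity
    calc s ^ 2 ≤ (∑ b, ‖(Q *ᵥ z) b‖ * ‖ψ b‖) ^ 2 := by gcongr
      _ ≤ (∑ b, ‖(Q *ᵥ z) b‖ ^ 2) * ∑ b, ‖ψ b‖ ^ 2 := Finset.sum_mul_sq_le_sq_mul_sq _ _ _
      _ = c * s := by rw [hψ, mul_one, h2']
  have hs0 : 0 ≤ s := Finset.sum_nonneg fun b _ => by positivity
  rcases hs0.eq_or_lt with h | h
  · have hQ0 : (0 : ℂ) ≤ Q (fun _ => true) (fun _ => true) := by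
      rw [← hQQ]
      nth_rw 1 [← hH]
      exact (Matrix.posSemidef_conjTranspose_mul_self Q).diag_nonneg
    rw [hc] at hQ0
    rw [← h]
    exact_mod_cast hQ0
  · nlinarith

/-- Let `D` project the inputs of `S` onto their values in `x`. It fixes the initial state, so `U D
Uᴴ` fixes the evolved state and bounds the all-ones probability by its diagonal entry at `e`.
Averaging that entry over `x` gives exactly `2 ^ (-|S|)`, because row `e` of `U` is a unit vector.
-/
theorem OneDQACWithInput.sum_allOnes_le (C : OneDQACWithInput n N d)
    {U : Matrix (QBits N) (QBits N) ℂ} (hU : U ∈ Matrix.unitaryGroup (QBits N) ℂ)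
    (S : Finset (Fin n)) (T : Finset (Fin N))
    (hT : ∀ A, SuppOn (C.input '' S) A → SuppOn (T : Set (Fin N)) (U * A * Uᴴ)) :
    ∑ x : Fin n → Bool, ∑ b : QBits N,
        (if ∀ q ∈ T, b q = true then ‖(U * C.initialMatrix) b x‖ ^ 2 else 0)
      ≤ 2 ^ n / 2 ^ S.card := by
  set e : QBits N := fun _ => true with he
  set c : (Fin n → Bool) → ℝ := fun x =>
    ∑ b : QBits N, ‖U e b‖ ^ 2 * if ∀ i ∈ S, b (C.input i) = x i then 1 else 0 with hc
  have hUU : Uᴴ * U = 1 := Matrix.mem_unitaryGroup_iff'.mp hU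
  have hsum : ∑ x, c x = 2 ^ n / 2 ^ S.card := by
    have hrow : ∑ b, ‖U e b‖ ^ 2 = 1 := by
      have h := congrFun (congrFun (Matrix.mem_unitaryGroup_iff.mp hU) e) e
      rw [Matrix.mul_apply, Matrix.one_apply_eq] at h
      have h' : ((∑ b, ‖U e b‖ ^ 2 : ℝ) : ℂ) = 1 := by
        rw [← h, Complex.ofReal_sum]
        refine Finset.sum_congr rfl fun b _ => ?_
        rw [Complex.ofReal_pow]
        exact (Complex.mul_conj' _).symm
      exact_mod_cast h'
    simp only [hc]
    rw [Finset.sum_comm]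
    simp only [← Finset.mul_sum, Finset.sum_boole]
    simp only [card_filter_agree S fun i => _]
    rw [← Finset.sum_mul, hrow, one_mul]
  rw [← hsum]
  refine Finset.sum_le_sum fun x _ => ?_
  set D : Matrix (QBits N) (QBits N) ℂ :=
    Matrix.diagonal fun b => if ∀ i ∈ S, b (C.input i) = x i then 1 else 0 with hD
  have hDH : Dᴴ = D := by
    rw [hD, Matrix.diagonal_conjTranspose]
    congr 1
    funext b
    rw [Pi.star_apply]
    split_ifs <;> simp
  have hDD : D * D = D := by
    rw [hD, Matrix.diagonal_mul_diagonal]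
    congr 1
    funext b
    split_ifs <;> simp
  have hsupp : SuppOn (C.input '' S) D := by
    refine suppOn_diagonal fun b b' hb => ?_
    have : (∀ i ∈ S, b (C.input i) = x i) ↔ ∀ i ∈ S, b' (C.input i) = x i :=
      forall₂_congr fun i hi => by rw [hb _ ⟨i, hi, rfl⟩]
    simp only [this]
  have hDV : D *ᵥ C.initialState x = C.initialState x := by
    funext b
    rw [hD, Matrix.mulVec_diagonal]
    unfold OneDQACWithInput.initialState
    by_cases h : ∀ i, b (C.input i) = x i
    · rw [if_pos fun i _ => h i, one_mul]
    · rw [if_neg h, mul_zero]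
  refine sum_norm_sq_le_of_suppOn (Q := U * D * Uᴴ) (ψ := U *ᵥ C.initialState x)
    (hT D hsupp) ?_ ?_ ?_ ?_ ?_
  · simp only [Matrix.conjTranspose_mul, Matrix.conjTranspose_conjTranspose, hDH, Matrix.mul_assoc]
  · calc U * D * Uᴴ * (U * D * Uᴴ) = U * D * (Uᴴ * U) * D * Uᴴ := by simp only [Matrix.mul_assoc]
      _ = U * (D * D) * Uᴴ := by rw [hUU, Matrix.mul_one]; simp only [Matrix.mul_assoc]
      _ = _ := by rw [hDD]
  · exact (sum_norm_sq_unitary_mul hU C.initialMatrix x).trans (C.sum_norm_sq_initialState x)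
  · rw [Matrix.mulVec_mulVec, Matrix.mul_assoc, hUU, Matrix.mul_one, ← Matrix.mulVec_mulVec, hDV]
  · rw [Matrix.mul_apply, hc, Complex.ofReal_sum]
    refine Finset.sum_congr rfl fun b _ => ?_
    rw [hD, Matrix.mul_diagonal, Matrix.conjTranspose_apply]
    have hm : U e b * star (U e b) = ((‖U e b‖ ^ 2 : ℝ) : ℂ) := by
      rw [Complex.ofReal_pow]
      exact Complex.mul_conj' _
    split_ifs
    · rw [mul_one, mul_one, ← hm]
    · simp

/-! ### Truncation of the circuit and its cost -/

open Classical in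
/-- The gates of a layer that satisfy `p`. -/
noncomputable def CZLayer.restrict (M : CZLayer N) (p : Finset (Fin N) → Prop) : CZLayer N where
  gates := M.gates.filter p
  contiguous T hT := M.contiguous T (Finset.mem_filter.mp hT).1
  disjoint := M.disjoint.subset fun _ hT => (Finset.mem_filter.mp hT).1

theorem CZLayer.mem_restrict {M : CZLayer N} {p : Finset (Fin N) → Prop} {T : Finset (Fin N)} :
    T ∈ (M.restrict p).gates ↔ T ∈ M.gates ∧ p T := by
  simp only [restrict, Finset.mem_filter]

theorem norm_prod_czPhase (G : Finset (Finset (Fin N))) (b : QBits N) :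
    ‖∏ T ∈ G, czPhase T b‖ = 1 := by
  rw [norm_prod]
  refine Finset.prod_eq_one fun T _ => ?_
  unfold czPhase
  split_ifs <;> simp

/-- The two diagonal phases agree unless some deleted gate sees all ones, and they never differ by
more than 2. A union bound over the deleted gates finishes. -/
theorem CZLayer.norm_sub_restrict_mul_sq_le (M : CZLayer N) (p : Finset (Fin N) → Prop)
    {m : Type*} [Fintype m] (Y : Matrix (QBits N) m ℂ) {R : Finset (Finset (Fin N))}
    (hR : ∀ T, T ∈ R ↔ T ∈ M.gates ∧ ¬ p T) :
    ‖(M.toMatrix - (M.restrict p).toMatrix) * Y‖ ^ 2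
      ≤ 4 * ∑ T ∈ R, ∑ x, ∑ b : QBits N,
          if ∀ q ∈ T, b q = true then ‖Y b x‖ ^ 2 else 0 := by
  classical
  have hdiag : M.toMatrix - (M.restrict p).toMatrix = Matrix.diagonal fun b =>
      (∏ T ∈ M.gates, czPhase T b) - ∏ T ∈ (M.restrict p).gates, czPhase T b := by
    rw [toMatrix, toMatrix, Matrix.diagonal_sub]
  have hRf : R = M.gates.filter fun T => ¬ p T := by
    ext T
    rw [hR, Finset.mem_filter]
  have hMf : (M.restrict p).gates = M.gates.filter p := by
    ext T
    rw [mem_restrict, Finset.mem_filter]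
  rw [frobenius_norm_sq, Finset.sum_comm, Finset.sum_comm (s := R), Finset.mul_sum]
  refine Finset.sum_le_sum fun x _ => ?_
  rw [Finset.sum_comm, Finset.mul_sum]
  refine Finset.sum_le_sum fun b _ => ?_
  rw [hdiag, Matrix.diagonal_mul, norm_mul, mul_pow]
  by_cases h : ∃ T ∈ R, ∀ q ∈ T, b q = true
  · obtain ⟨T, hT, hTb⟩ := h
    have h1 : ‖Y b x‖ ^ 2 ≤ ∑ T ∈ R, if ∀ q ∈ T, b q = true then ‖Y b x‖ ^ 2 else 0 := by
      refine le_trans (by rw [if_pos hTb]) (Finset.single_le_sum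
        (f := fun T : Finset (Fin N) => if ∀ q ∈ T, b q = true then ‖Y b x‖ ^ 2 else 0)
        (fun T _ => ?_) hT)
      split_ifs <;> positivity
    have h2 : ‖(∏ T ∈ M.gates, czPhase T b) - ∏ T ∈ (M.restrict p).gates, czPhase T b‖ ≤ 2 := by
      refine (norm_sub_le _ _).trans ?_
      rw [norm_prod_czPhase, norm_prod_czPhase]
      norm_num
    have h3 : ‖(∏ T ∈ M.gates, czPhase T b) - ∏ T ∈ (M.restrict p).gates, czPhase T b‖ ^ 2
        ≤ 4 := by
      calc _ ≤ (2 : ℝ) ^ 2 := by gcongr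
        _ = 4 := by norm_num
    exact mul_le_mul h3 h1 (by positivity) (by norm_num)
  · have h1 : ∏ T ∈ R, czPhase T b = 1 := by
      refine Finset.prod_eq_one fun T hT => if_neg fun hb => h ⟨T, hT, hb⟩
    have h2 : (∏ T ∈ M.gates, czPhase T b) = ∏ T ∈ (M.restrict p).gates, czPhase T b := by
      rw [← Finset.prod_filter_mul_prod_filter_not M.gates p, ← hRf, h1, mul_one, hMf]
    rw [h2, sub_self, norm_zero]
    simp only [ne_eq, OfNat.ofNat_ne_zero, not_false_eq_true, zero_pow, zero_mul]
    refine mul_nonneg (by norm_num) (Finset.sum_nonneg fun T _ => ?_)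
    split_ifs <;> positivity

open Classical in
/-- The inputs whose forward light cone is contained in `T`. -/
noncomputable def OneDQAC.safe (input : Fin n ↪ Fin N) (C : OneDQAC N d) (T : Finset (Fin N)) :
    Finset (Fin n) :=
  Finset.univ.filter fun i => C.cone {input i} ⊆ T

theorem OneDQAC.mem_safe {input : Fin n ↪ Fin N} {C : OneDQAC N d} {T : Finset (Fin N)}
    {i : Fin n} : i ∈ C.safe input T ↔ C.cone {input i} ⊆ T := by
  simp only [safe, Finset.mem_filter, Finset.mem_univ, true_and]

/-- The circuit without the gates that contain the light cones of at least `k` inputs; here the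
light cones are those of the circuit from which the gates of the earlier layers are already
removed. -/
noncomputable def OneDQAC.trunc (input : Fin n ↪ Fin N) (k : ℕ) :
    {d : ℕ} → OneDQAC N d → OneDQAC N d
  | _, .base L => .base L
  | _, .layer C M L => .layer (C.trunc input k)
      (M.restrict fun T => ((C.trunc input k).safe input T).card < k) L

/-- A cone contains its own input, so disjoint gates have disjoint sets of safe inputs. -/
theorem CZLayer.card_mul_le (M : CZLayer N) (input : Fin n ↪ Fin N) (C : OneDQAC N d) (k : ℕ)
    {R : Finset (Finset (Fin N))} (hR : ∀ T ∈ R, T ∈ M.gates ∧ k ≤ (C.safe input T).card) :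
    R.card * k ≤ n := by
  have hdisj : (R : Set (Finset (Fin N))).PairwiseDisjoint (C.safe input) := by
    intro T hT T' hT' hne
    refine Finset.disjoint_left.mpr fun i hi hi' => ?_
    have hself := C.subset_cone {input i} (Set.mem_singleton _)
    exact Finset.disjoint_left.mp (M.disjoint (hR T hT).1 (hR T' hT').1 hne)
      (OneDQAC.mem_safe.mp hi hself) (OneDQAC.mem_safe.mp hi' hself)
  calc R.card * k = ∑ _T ∈ R, k := by rw [Finset.sum_const, smul_eq_mul]
    _ ≤ ∑ T ∈ R, (C.safe input T).card := Finset.sum_le_sum fun T hT => (hR T hT).2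
    _ = (R.biUnion (C.safe input)).card := (Finset.card_biUnion hdisj).symm
    _ ≤ n := by simpa using Finset.card_le_univ (R.biUnion (C.safe input))

theorem OneDQACWithInput.norm_sub_trunc_le (I : OneDQACWithInput n N d) {k : ℕ} (hk : 0 < k)
    {e : ℕ} (C : OneDQAC N e) :
    ‖(C.toMatrix - (C.trunc I.input k).toMatrix) * I.initialMatrix‖
      ≤ e * (2 * √(n / k * (2 ^ n / 2 ^ k))) := by
  classical
  induction C with
  | base L => simp [OneDQAC.trunc]
  | @layer e C M L ih =>
    set C' := C.trunc I.input k with hC'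
    set p : Finset (Fin N) → Prop := fun T => (C'.safe I.input T).card < k with hp
    set M' := M.restrict p with hM'
    set V := I.initialMatrix with hV
    -- Hybrid argument: the earlier error is carried along by unitaries, and the new error is
    -- measured on the state of the truncated prefix, whose cones define the deletion.
    have hsplit : ((OneDQAC.layer C M L).toMatrix
          - ((OneDQAC.layer C M L).trunc I.input k).toMatrix) * V
        = L.toMatrix * (M.toMatrix * ((C.toMatrix - C'.toMatrix) * V)
          + (M.toMatrix - M'.toMatrix) * (C'.toMatrix * V)) := by
      simp only [OneDQAC.trunc, OneDQAC.toMatrix, Matrix.sub_mul, Matrix.mul_sub,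
        Matrix.mul_assoc, sub_add_sub_cancel]
      rfl
    set R := M.gates.filter fun T => ¬ p T with hR
    have hRmem : ∀ T ∈ R, T ∈ M.gates ∧ k ≤ (C'.safe I.input T).card := fun T hT =>
      ⟨(Finset.mem_filter.mp hT).1, not_lt.mp (Finset.mem_filter.mp hT).2⟩
    have hgate : ∀ T ∈ R, ∑ x, ∑ b : QBits N,
        (if ∀ q ∈ T, b q = true then ‖(C'.toMatrix * V) b x‖ ^ 2 else 0) ≤ 2 ^ n / 2 ^ k := by
      intro T hT
      refine (I.sum_allOnes_le C'.toMatrix_mem_unitaryGroup (C'.safe I.input T) T ?_).trans ?_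
      · intro A hA
        refine (hA.conj_circuit C').mono fun q hq => ?_
        obtain ⟨r, ⟨i, hi, rfl⟩, hr⟩ := (C'.mem_cone_iff _ q).mp hq
        exact OneDQAC.mem_safe.mp hi hr
      · gcongr
        · norm_num
        · exact (hRmem T hT).2
    have hcard : (R.card : ℝ) ≤ n / k := by
      rw [le_div_iff₀ (by exact_mod_cast hk)]
      exact_mod_cast M.card_mul_le I.input C' k hRmem
    have hlayer : ‖(M.toMatrix - M'.toMatrix) * (C'.toMatrix * V)‖
        ≤ 2 * √(n / k * (2 ^ n / 2 ^ k)) := by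
      refine le_of_sq_le_sq ?_ (by positivity)
      rw [mul_pow, Real.sq_sqrt (by positivity)]
      refine (M.norm_sub_restrict_mul_sq_le p (C'.toMatrix * V) (R := R)
        fun T => Finset.mem_filter).trans ?_
      have : ∑ T ∈ R, ∑ x, ∑ b : QBits N,
          (if ∀ q ∈ T, b q = true then ‖(C'.toMatrix * V) b x‖ ^ 2 else 0)
          ≤ n / k * (2 ^ n / 2 ^ k) := by
        refine (Finset.sum_le_card_nsmul R _ _ hgate).trans ?_
        rw [nsmul_eq_mul]
        gcongr
      linarith
    rw [hsplit, frobenius_norm_unitary_mul L.toMatrix_mem_unitaryGroup]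
    refine (norm_add_le _ _).trans ?_
    rw [frobenius_norm_unitary_mul (U := M.toMatrix) (diagonal_czPhase_mem_unitaryGroup _)]
    push_cast
    linarith

end Frobenius

/-! ### Light cones crossing a cut of the line -/

section Crossing

variable {n N d : ℕ}

open Classical in
/-- The inputs left of the cut `c` whose light cone crosses the cut. -/
noncomputable def OneDQAC.rightCross (input : Fin n ↪ Fin N) (C : OneDQAC N d) (c : ℕ) :
    Finset (Fin n) :=
  Finset.univ.filter fun i => (input i : ℕ) < c ∧ ∃ q ∈ C.cone {input i}, c ≤ (q : ℕ)

open Classical in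
/-- The inputs right of the cut `c` whose light cone crosses the cut. -/
noncomputable def OneDQAC.leftCross (input : Fin n ↪ Fin N) (C : OneDQAC N d) (c : ℕ) :
    Finset (Fin n) :=
  Finset.univ.filter fun i => c ≤ (input i : ℕ) ∧ ∃ q ∈ C.cone {input i}, (q : ℕ) < c

/-- The inputs with position in `T`. -/
def inputsIn (input : Fin n ↪ Fin N) (T : Finset (Fin N)) : Finset (Fin n) :=
  Finset.univ.filter fun i => input i ∈ T

theorem OneDQAC.mem_rightCross {input : Fin n ↪ Fin N} {C : OneDQAC N d} {c : ℕ} {i : Fin n} :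
    i ∈ C.rightCross input c ↔
      (input i : ℕ) < c ∧ ∃ q ∈ C.cone {input i}, c ≤ (q : ℕ) := by
  simp only [rightCross, Finset.mem_filter, Finset.mem_univ, true_and]

theorem OneDQAC.mem_leftCross {input : Fin n ↪ Fin N} {C : OneDQAC N d} {c : ℕ} {i : Fin n} :
    i ∈ C.leftCross input c ↔
      c ≤ (input i : ℕ) ∧ ∃ q ∈ C.cone {input i}, (q : ℕ) < c := by
  simp only [leftCross, Finset.mem_filter, Finset.mem_univ, true_and]

theorem mem_inputsIn {input : Fin n ↪ Fin N} {T : Finset (Fin N)} {i : Fin n} :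
    i ∈ inputsIn input T ↔ input i ∈ T := by
  simp only [inputsIn, Finset.mem_filter, Finset.mem_univ, true_and]

/-- The cone of an input in the interval either stays inside it or leaves across one of its two
ends. -/
theorem OneDQAC.card_inputsIn_le (input : Fin n ↪ Fin N) (C : OneDQAC N d) (a b : Fin N) :
    (inputsIn input (Finset.Icc a b)).card ≤ (C.safe input (Finset.Icc a b)).card
      + (C.rightCross input (b + 1)).card + (C.leftCross input a).card := by
  have hsub : inputsIn input (Finset.Icc a b) ⊆ (C.safe input (Finset.Icc a b)
      ∪ C.rightCross input (b + 1)) ∪ C.leftCross input a := by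
    intro i hi
    rw [mem_inputsIn, Finset.mem_Icc, Fin.le_def, Fin.le_def] at hi
    by_cases hs : C.cone {input i} ⊆ (Finset.Icc a b : Finset (Fin N))
    · exact Finset.mem_union_left _ (Finset.mem_union_left _ (mem_safe.mpr hs))
    · obtain ⟨q, hq, hqT⟩ := Set.not_subset.mp hs
      rw [Finset.mem_coe, Finset.mem_Icc, Fin.le_def, Fin.le_def] at hqT
      by_cases hqa : (q : ℕ) < a
      · exact Finset.mem_union_right _ (mem_leftCross.mpr ⟨hi.1, q, hq, hqa⟩)
      · exact Finset.mem_union_left _ (Finset.mem_union_right _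
          (mem_rightCross.mpr ⟨by lia, q, hq, by lia⟩))
  exact (Finset.card_le_card hsub).trans ((Finset.card_union_le _ _).trans
    (Nat.add_le_add_right (Finset.card_union_le _ _) _))

theorem CZLayer.eq_of_mem {M : CZLayer N} {T T' : Finset (Fin N)} (hT : T ∈ M.gates)
    (hT' : T' ∈ M.gates) {q : Fin N} (hq : q ∈ T) (hq' : q ∈ T') : T = T' := by
  by_contra h
  exact Finset.disjoint_left.mp (M.disjoint hT hT' h) hq hq'

/-- If a gate `[a, b]` straddles the cut, a newly crossing input lies in `[a, b]` or had a cone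
already crossing the cut `a`. With `card_inputsIn_le` the new count is at most `m` plus three old
crossing counts. The form `2 * r + m` makes this recursion homogeneous with factor 3. -/
theorem OneDQAC.card_rightCross_layer_le (input : Fin n ↪ Fin N) (C : OneDQAC N d)
    (M : CZLayer N) (L : SingleLayer N) {m K : ℕ}
    (hm : ∀ T ∈ M.gates, (C.safe input T).card ≤ m)
    (hr : ∀ c, 2 * (C.rightCross input c).card + m ≤ K)
    (hl : ∀ c, 2 * (C.leftCross input c).card + m ≤ K) (c : ℕ) :
    2 * ((OneDQAC.layer C M L).rightCross input c).card + m ≤ 3 * K := by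
  by_cases hg : ∃ T ∈ M.gates, ∃ r ∈ T, ∃ s ∈ T, (r : ℕ) < c ∧ c ≤ (s : ℕ)
  · obtain ⟨T, hT, r, hrT, s, hsT, hrc, hcs⟩ := hg
    obtain ⟨a, b, hab, rfl⟩ := M.contiguous T hT
    rw [Finset.mem_Icc, Fin.le_def, Fin.le_def] at hrT hsT
    have hsub : (OneDQAC.layer C M L).rightCross input c
        ⊆ inputsIn input (Finset.Icc a b) ∪ C.rightCross input a := by
      intro i hi
      obtain ⟨hic, q, hq, hcq⟩ := mem_rightCross.mp hi
      by_cases hia : (a : ℕ) ≤ input i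
      · refine Finset.mem_union_left _ (mem_inputsIn.mpr ?_)
        rw [Finset.mem_Icc, Fin.le_def, Fin.le_def]
        exact ⟨hia, by lia⟩
      · refine Finset.mem_union_right _ (mem_rightCross.mpr ⟨by lia, ?_⟩)
        rcases hq with hq | ⟨T', hT', hqT', p, hpT', hp⟩
        · exact ⟨q, hq, by lia⟩
        · by_cases hpc : c ≤ (p : ℕ)
          · exact ⟨p, hp, by lia⟩
          · obtain ⟨a', b', hab', rfl⟩ := M.contiguous T' hT'
            -- A gate reaching from `p < c` to `q ≥ c` is an interval, hence contains the qubit `c`.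
            -- So does `[a, b]`, and disjointness makes the two gates equal.
            have hmem : (⟨c, hcq.trans_lt q.2⟩ : Fin N) ∈ Finset.Icc a' b' := by
              rw [Finset.mem_Icc, Fin.le_def, Fin.le_def] at hqT' hpT' ⊢
              simp only
              lia
            have hmem' : (⟨c, hcq.trans_lt q.2⟩ : Fin N) ∈ Finset.Icc a b := by
              rw [Finset.mem_Icc, Fin.le_def, Fin.le_def]
              simp only
              lia
            rw [CZLayer.eq_of_mem hT' hT hmem hmem', Finset.mem_Icc, Fin.le_def] at hpT'
            exact ⟨p, hp, hpT'.1⟩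
    have h1 := (Finset.card_le_card hsub).trans (Finset.card_union_le _ _)
    have h2 := C.card_inputsIn_le input a b
    have h3 := hm _ hT
    have h4 := hr a
    have h5 := hr (b + 1)
    have h6 := hl a
    lia
  · have hsub : (OneDQAC.layer C M L).rightCross input c ⊆ C.rightCross input c := by
      intro i hi
      obtain ⟨hic, q, hq, hcq⟩ := mem_rightCross.mp hi
      refine mem_rightCross.mpr ⟨hic, ?_⟩
      rcases hq with hq | ⟨T', hT', hqT', p, hpT', hp⟩
      · exact ⟨q, hq, hcq⟩
      · exact ⟨p, hp, not_lt.mp fun hpc => hg ⟨T', hT', p, hpT', q, hqT', hpc, hcq⟩⟩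
    have h1 := Finset.card_le_card hsub
    have h2 := hr c
    lia

theorem OneDQAC.card_leftCross_layer_le (input : Fin n ↪ Fin N) (C : OneDQAC N d)
    (M : CZLayer N) (L : SingleLayer N) {m K : ℕ}
    (hm : ∀ T ∈ M.gates, (C.safe input T).card ≤ m)
    (hr : ∀ c, 2 * (C.rightCross input c).card + m ≤ K)
    (hl : ∀ c, 2 * (C.leftCross input c).card + m ≤ K) (c : ℕ) :
    2 * ((OneDQAC.layer C M L).leftCross input c).card + m ≤ 3 * K := by
  by_cases hg : ∃ T ∈ M.gates, ∃ r ∈ T, ∃ s ∈ T, (r : ℕ) < c ∧ c ≤ (s : ℕ)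
  · obtain ⟨T, hT, r, hrT, s, hsT, hrc, hcs⟩ := hg
    obtain ⟨a, b, hab, rfl⟩ := M.contiguous T hT
    rw [Finset.mem_Icc, Fin.le_def, Fin.le_def] at hrT hsT
    have hsub : (OneDQAC.layer C M L).leftCross input c
        ⊆ inputsIn input (Finset.Icc a b) ∪ C.leftCross input (b + 1) := by
      intro i hi
      obtain ⟨hic, q, hq, hcq⟩ := mem_leftCross.mp hi
      by_cases hib : (input i : ℕ) ≤ b
      · refine Finset.mem_union_left _ (mem_inputsIn.mpr ?_)
        rw [Finset.mem_Icc, Fin.le_def, Fin.le_def]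
        exact ⟨by lia, hib⟩
      · refine Finset.mem_union_right _ (mem_leftCross.mpr ⟨by lia, ?_⟩)
        rcases hq with hq | ⟨T', hT', hqT', p, hpT', hp⟩
        · exact ⟨q, hq, by lia⟩
        · by_cases hpc : (p : ℕ) < c
          · exact ⟨p, hp, by lia⟩
          · obtain ⟨a', b', hab', rfl⟩ := M.contiguous T' hT'
            have hcN : c < N := hcs.trans_lt s.2
            have hmem : (⟨c, hcN⟩ : Fin N) ∈ Finset.Icc a' b' := by
              rw [Finset.mem_Icc, Fin.le_def, Fin.le_def] at hqT' hpT' ⊢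
              simp only
              lia
            have hmem' : (⟨c, hcN⟩ : Fin N) ∈ Finset.Icc a b := by
              rw [Finset.mem_Icc, Fin.le_def, Fin.le_def]
              simp only
              lia
            rw [CZLayer.eq_of_mem hT' hT hmem hmem', Finset.mem_Icc, Fin.le_def, Fin.le_def]
              at hpT'
            exact ⟨p, hp, by lia⟩
    have h1 := (Finset.card_le_card hsub).trans (Finset.card_union_le _ _)
    have h2 := C.card_inputsIn_le input a b
    have h3 := hm _ hT
    have h4 := hl a
    have h5 := hr (b + 1)
    have h6 := hl (b + 1)
    lia
  · have hsub : (OneDQAC.layer C M L).leftCross input c ⊆ C.leftCross input c := by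
      intro i hi
      obtain ⟨hic, q, hq, hcq⟩ := mem_leftCross.mp hi
      refine mem_leftCross.mpr ⟨hic, ?_⟩
      rcases hq with hq | ⟨T', hT', hqT', p, hpT', hp⟩
      · exact ⟨q, hq, hcq⟩
      · exact ⟨p, hp, not_le.mp fun hpc => hg ⟨T', hT', q, hqT', p, hpT', hcq, hpc⟩⟩
    have h1 := Finset.card_le_card hsub
    have h2 := hl c
    lia

theorem OneDQAC.card_cross_trunc_le (input : Fin n ↪ Fin N) (m : ℕ) (C : OneDQAC N d) :
    (∀ c, 2 * ((C.trunc input (m + 1)).rightCross input c).card + m ≤ m * 3 ^ d) ∧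
      ∀ c, 2 * ((C.trunc input (m + 1)).leftCross input c).card + m ≤ m * 3 ^ d := by
  induction C with
  | base L =>
    constructor <;> intro c
    · have : ((OneDQAC.base L).trunc input (m + 1)).rightCross input c = ∅ := by
        refine Finset.eq_empty_of_forall_notMem fun i hi => ?_
        obtain ⟨h, q, rfl, hq⟩ := mem_rightCross.mp hi
        lia
      simp [this]
    · have : ((OneDQAC.base L).trunc input (m + 1)).leftCross input c = ∅ := by
        refine Finset.eq_empty_of_forall_notMem fun i hi => ?_
        obtain ⟨h, q, rfl, hq⟩ := mem_leftCross.mp hi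
        lia
      simp [this]
  | @layer e C M L ih =>
    have hpow : m * 3 ^ (e + 1) = 3 * (m * 3 ^ e) := by ring
    have hm : ∀ T ∈ (M.restrict fun T =>
        ((C.trunc input (m + 1)).safe input T).card < m + 1).gates,
        ((C.trunc input (m + 1)).safe input T).card ≤ m :=
      fun T hT => Nat.lt_succ_iff.mp (CZLayer.mem_restrict.mp hT).2
    rw [hpow]
    exact ⟨card_rightCross_layer_le input _ _ L hm ih.1 ih.2,
      card_leftCross_layer_le input _ _ L hm ih.1 ih.2⟩

theorem OneDQAC.exists_notMem_cone_trunc (input : Fin n ↪ Fin N) (m : ℕ) (C : OneDQAC N d)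
    (hn : m * 3 ^ d + 1 < n + m) (o : Fin N) :
    ∃ i, o ∉ (C.trunc input (m + 1)).cone {input i} := by
  classical
  by_contra! h
  set C' := C.trunc input (m + 1) with hC'
  -- If the output were in every cone, each input left of it would cross the cut `o`, each input
  -- right of it the cut `o + 1`, and at most one input sits at `o` itself.
  have hsub : (Finset.univ : Finset (Fin n))
      ⊆ (C'.rightCross input o ∪ C'.leftCross input (o + 1))
        ∪ Finset.univ.filter fun i => input i = o := by
    intro i _
    rcases lt_trichotomy (input i : ℕ) o with hi | hi | hi
    · exact Finset.mem_union_left _ (Finset.mem_union_left _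
        (mem_rightCross.mpr ⟨hi, o, h i, le_rfl⟩))
    · exact Finset.mem_union_right _ (Finset.mem_filter.mpr ⟨Finset.mem_univ i, Fin.ext hi⟩)
    · exact Finset.mem_union_left _ (Finset.mem_union_right _
        (mem_leftCross.mpr ⟨hi, o, h i, Nat.lt_succ_self _⟩))
  have h1 := (Finset.card_le_card hsub).trans ((Finset.card_union_le _ _).trans
    (Nat.add_le_add_right (Finset.card_union_le _ _) _))
  have h2 : (Finset.univ.filter fun i => input i = o).card ≤ 1 := by
    refine Finset.card_le_one.mpr fun i hi j hj => input.injective ?_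
    rw [(Finset.mem_filter.mp hi).2, (Finset.mem_filter.mp hj).2]
  rw [Finset.card_univ, Fintype.card_fin] at h1
  have h3 := (C.card_cross_trunc_le input m).1 o
  have h4 := (C.card_cross_trunc_le input m).2 (o + 1)
  lia

end Crossing

/-! ### An unseen input makes parity a fair coin -/

section Parity

variable {n N d : ℕ}

theorem parityFn_update_not (x : Fin n → Bool) (i : Fin n) :
    parityFn n (Function.update x i (!x i)) = !parityFn n x := by
  set s := Finset.univ.filter fun j => x j = true with hs
  set s' := Finset.univ.filter fun j => Function.update x i (!x i) j = true with hs'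
  have key : Odd s'.card ↔ ¬ Odd s.card := by
    by_cases hi : x i = true
    · have h : s' = s.erase i := by
        ext j
        by_cases hj : j = i
        · subst hj; simp [hs', hi]
        · simp [hs, hs', hj]
      have hmem : i ∈ s := by simp [hs, hi]
      rw [← Finset.card_erase_add_one hmem, ← h, Nat.odd_add_one, not_not]
    · have h : s' = insert i s := by
        ext j
        by_cases hj : j = i
        · subst hj; simp [hs', hi]
        · simp [hs, hs', hj]
      have hmem : i ∉ s := by simp [hs, hi]
      rw [h, Finset.card_insert_of_notMem hmem, Nat.odd_add_one]
  unfold parityFn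
  rw [decide_eq_decide.mpr key, decide_not]

/-- The Pauli matrix that exchanges the two basis states. -/
def pauliX : Matrix Bool Bool ℂ :=
  Matrix.of fun u v => if u = v then 0 else 1

theorem pauliX_mem_unitaryGroup : pauliX ∈ Matrix.unitaryGroup Bool ℂ := by
  rw [Matrix.mem_unitaryGroup_iff]
  ext u v
  cases u <;> cases v <;> simp [pauliX, Matrix.mul_apply]

theorem siteOp_mem_unitaryGroup (q : Fin N) {m : Matrix Bool Bool ℂ}
    (hm : m ∈ Matrix.unitaryGroup Bool ℂ) : siteOp q m ∈ Matrix.unitaryGroup (QBits N) ℂ := by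
  have h : siteOp q m = SingleLayer.toMatrix (Function.update 1 q ⟨m, hm⟩) := by
    rw [SingleLayer.toMatrix_eq, siteOp]
    congr 1
    funext r
    by_cases hr : r = q
    · subst hr; simp
    · simp [hr]
  rw [h]
  exact SingleLayer.toMatrix_mem_unitaryGroup _

theorem OneDQACWithInput.pauliX_mul_initialMatrix (C : OneDQACWithInput n N d) (i : Fin n)
    (b : QBits N) (x : Fin n → Bool) :
    (siteOp (C.input i) pauliX * C.initialMatrix) b x
      = C.initialMatrix b (Function.update x i (!x i)) := by
  rw [Matrix.mul_apply,
    Finset.sum_eq_single (Function.update b (C.input i) (!b (C.input i)))]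
  · rw [siteOp_apply, if_pos fun r hr => (Function.update_of_ne hr _ _).symm]
    simp only [pauliX, initialMatrix, initialState, Matrix.of_apply, Function.update_self]
    rw [if_neg (by simp), one_mul]
    have hiff : (∀ j, Function.update b (C.input i) (!b (C.input i)) (C.input j) = x j)
        ↔ ∀ j, b (C.input j) = Function.update x i (!x i) j := by
      refine forall_congr' fun j => ?_
      by_cases hj : j = i
      · subst hj
        rw [Function.update_self, Function.update_self]
        cases b (C.input j) <;> cases x j <;> simp
      · rw [Function.update_of_ne hj, Function.update_of_ne (C.input.injective.ne hj)]
    have hanc : (fun q : {q : Fin N // q ∉ Set.range C.input} =>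
        Function.update b (C.input i) (!b (C.input i)) q.1) = fun q => b q.1 := by
      funext q
      exact Function.update_of_ne (fun h => q.2 ⟨i, h.symm⟩) _ _
    simp only [hiff, hanc]
  · intro c _ hc
    rw [siteOp_apply]
    split_ifs with h
    · have : b (C.input i) = c (C.input i) := by
        by_contra hne
        refine hc (funext fun r => ?_)
        by_cases hr : r = C.input i
        · subst hr
          rw [Function.update_self]
          revert hne
          cases b (C.input i) <;> cases c (C.input i) <;> simp
        · rw [Function.update_of_ne hr, h r hr]
      simp [pauliX, this]
    · simp
  · simp

/-- If the output is outside the light cone of an input, the distribution of the outcome does not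
depend on that input. -/
theorem OneDQACWithInput.outcome_update_eq (I : OneDQACWithInput n N d) {e : ℕ} (C : OneDQAC N e)
    {i : Fin n} {o : Fin N} (ho : o ∉ C.cone {I.input i}) (x : Fin n → Bool) (v : Bool) :
    ∑ b : QBits N, (if b o = v then
        ‖(C.toMatrix * I.initialMatrix) b (Function.update x i (!x i))‖ ^ 2 else 0)
      = ∑ b : QBits N, if b o = v then ‖(C.toMatrix * I.initialMatrix) b x‖ ^ 2 else 0 := by
  set U := C.toMatrix with hU
  set V := I.initialMatrix with hV
  set X := siteOp (I.input i) pauliX with hX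
  -- Flipping the input bit before the circuit amounts to applying `W` after it. `W` is a unitary
  -- supported on the cone, so it commutes with the projection of the output onto `v`.
  set W := U * X * Uᴴ with hW
  have hUmem : U ∈ Matrix.unitaryGroup (QBits N) ℂ := C.toMatrix_mem_unitaryGroup
  have hWmem : W ∈ Matrix.unitaryGroup (QBits N) ℂ :=
    mul_mem (mul_mem hUmem (siteOp_mem_unitaryGroup _ pauliX_mem_unitaryGroup))
      (Unitary.star_mem hUmem)
  have hflip : ∀ b, (U * V) b (Function.update x i (!x i)) = (W * (U * V)) b x := by
    intro b
    have huu : Uᴴ * U = 1 := Matrix.mem_unitaryGroup_iff'.mp hUmem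
    have h : W * (U * V) = U * (X * V) := by
      calc W * (U * V) = U * X * (Uᴴ * U) * V := by rw [hW]; simp only [Matrix.mul_assoc]
        _ = U * (X * V) := by rw [huu, Matrix.mul_one, Matrix.mul_assoc]
    rw [h, Matrix.mul_apply, Matrix.mul_apply]
    exact Finset.sum_congr rfl fun c _ => by rw [I.pauliX_mul_initialMatrix]
  have hcomm := (((suppOn_siteOp (I.input i) pauliX).conj_circuit C) o ho
    (Matrix.single v v 1)).eq
  have hmask : ∀ Y : Matrix (QBits N) (Fin n → Bool) ℂ,
      ∑ b : QBits N, (if b o = v then ‖Y b x‖ ^ 2 else 0)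
        = ∑ b, ‖(siteOp o (Matrix.single v v 1) * Y) b x‖ ^ 2 := by
    intro Y
    refine Finset.sum_congr rfl fun b _ => ?_
    rw [siteOp_single_mul]
    split_ifs with h
    · rw [← h, Function.update_eq_self]
    · simp
  simp only [hflip]
  rw [hmask, hmask, ← Matrix.mul_assoc, hcomm, Matrix.mul_assoc,
    sum_norm_sq_unitary_mul hWmem]

theorem OneDQACWithInput.sum_outcome_parity_eq (I : OneDQACWithInput n N d) {e : ℕ}
    (C : OneDQAC N e) {i : Fin n} {o : Fin N} (ho : o ∉ C.cone {I.input i}) :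
    ∑ x, ∑ b : QBits N, (if b o = parityFn n x then ‖(C.toMatrix * I.initialMatrix) b x‖ ^ 2
      else 0) = 2 ^ n / 2 := by
  set p : (Fin n → Bool) → Bool → ℝ := fun x v =>
    ∑ b : QBits N, if b o = v then ‖(C.toMatrix * I.initialMatrix) b x‖ ^ 2 else 0 with hp
  have hinv : Function.Involutive fun x : Fin n → Bool => Function.update x i (!x i) := by
    intro x
    simp
  have hflip : ∑ x, p x (parityFn n x) = ∑ x, p x (!parityFn n x) := by
    rw [← Equiv.sum_comp hinv.toPerm]
    refine Finset.sum_congr rfl fun x _ => ?_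
    have h := I.outcome_update_eq C ho x (!parityFn n x)
    rw [← parityFn_update_not x i] at h ⊢
    exact h
  have hone : ∀ x, p x (parityFn n x) + p x (!parityFn n x) = 1 := by
    intro x
    simp only [hp]
    rw [← Finset.sum_add_distrib, ← I.sum_norm_sq_initialState x]
    refine Eq.trans (Finset.sum_congr rfl fun b _ => ?_)
      (sum_norm_sq_unitary_mul C.toMatrix_mem_unitaryGroup I.initialMatrix x)
    cases b o <;> cases parityFn n x <;> simp
  have hsum : ∑ x, p x (parityFn n x) + ∑ x, p x (!parityFn n x) = 2 ^ n := by
    rw [← Finset.sum_add_distrib, Finset.sum_congr rfl fun x _ => hone x]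
    simp
  change ∑ x, p x (parityFn n x) = 2 ^ n / 2
  linarith

open scoped Matrix.Norms.Frobenius in
theorem OneDQACWithInput.successProb_parity_le (I : OneDQACWithInput n N d) {m : ℕ}
    (hn : m * 3 ^ d + 1 < n + m) :
    I.successProb (parityFn n)
      ≤ 1 / 2 + 4 * d * √(n / ((m + 1 : ℕ) : ℝ) / 2 ^ (m + 1)) := by
  set C' := I.circuit.trunc I.input (m + 1) with hC'
  obtain ⟨i, hi⟩ := I.circuit.exists_notMem_cone_trunc I.input m hn I.output
  -- `mask` keeps the amplitudes giving the right answer, so the success probability is a normalized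
  -- squared Frobenius norm. As `mask` is a linear contraction, the truncation error bounds the
  -- change of that norm.
  set mask : Matrix (QBits N) (Fin n → Bool) ℂ → Matrix (QBits N) (Fin n → Bool) ℂ :=
    fun Y => Matrix.of fun b x => if b I.output = parityFn n x then Y b x else 0 with hmask
  have hmask_sq : ∀ Y, ‖mask Y‖ ^ 2
      = ∑ x, ∑ b : QBits N, if b I.output = parityFn n x then ‖Y b x‖ ^ 2 else 0 := by
    intro Y
    rw [frobenius_norm_sq, Finset.sum_comm]
    refine Finset.sum_congr rfl fun x _ => Finset.sum_congr rfl fun b _ => ?_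
    simp only [hmask, Matrix.of_apply]
    split_ifs <;> simp
  have hmask_le : ∀ Y, ‖mask Y‖ ≤ ‖Y‖ := by
    intro Y
    refine le_of_sq_le_sq ?_ (norm_nonneg _)
    rw [hmask_sq, frobenius_norm_sq, Finset.sum_comm]
    refine Finset.sum_le_sum fun b _ => Finset.sum_le_sum fun x _ => ?_
    split_ifs
    · exact le_rfl
    · positivity
  have hmask_sub : ∀ Y Y', mask Y - mask Y' = mask (Y - Y') := by
    intro Y Y'
    ext b x
    simp only [hmask, Matrix.sub_apply, Matrix.of_apply]
    split_ifs <;> simp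
  set Y := I.circuit.toMatrix * I.initialMatrix with hY
  set Y' := C'.toMatrix * I.initialMatrix with hY'
  set s : ℝ := √(2 ^ n) with hs
  have hs2 : s ^ 2 = 2 ^ n := Real.sq_sqrt (by positivity)
  have hspos : 0 < s := Real.sqrt_pos.mpr (by positivity)
  have hV : ‖I.initialMatrix‖ = s := by
    rw [hs, ← I.norm_initialMatrix_sq, Real.sqrt_sq (norm_nonneg _)]
  have hYs : ‖Y‖ = s := by
    rw [hY, frobenius_norm_unitary_mul I.circuit.toMatrix_mem_unitaryGroup, hV]
  have hYs' : ‖Y'‖ = s := by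
    rw [hY', frobenius_norm_unitary_mul C'.toMatrix_mem_unitaryGroup, hV]
  have hsucc : I.successProb (parityFn n) = ‖mask Y‖ ^ 2 / 2 ^ n := by
    rw [hmask_sq]
    rfl
  have hhalf : ‖mask Y'‖ ^ 2 = 2 ^ n / 2 := by
    rw [hmask_sq]
    exact I.sum_outcome_parity_eq C' hi
  set t := √(n / ((m + 1 : ℕ) : ℝ) / 2 ^ (m + 1)) with ht
  have hδ : ‖Y - Y'‖ ≤ d * (2 * (t * s)) := by
    have h := I.norm_sub_trunc_le (Nat.succ_pos m) I.circuit
    rw [Matrix.sub_mul] at h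
    refine h.trans (le_of_eq ?_)
    rw [ht, hs, ← Real.sqrt_mul (by positivity)]
    rw [Nat.succ_eq_add_one]
    congr 3
    ring
  have h1 : ‖mask Y‖ ≤ ‖mask Y'‖ + d * (2 * (t * s)) := by
    have h2 := norm_le_norm_add_norm_sub' (mask Y) (mask Y')
    rw [hmask_sub] at h2
    linarith [hmask_le (Y - Y')]
  have h2 : ‖mask Y‖ ≤ s := (hmask_le Y).trans hYs.le
  have h3 : ‖mask Y'‖ ≤ s := (hmask_le Y').trans hYs'.le
  have hδ0 : 0 ≤ d * (2 * (t * s)) := by positivity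
  -- Difference of squares: the norms differ by at most the truncation error, and their sum is at
  -- most `2 * s`.
  have h4 : ‖mask Y‖ ^ 2 ≤ 2 ^ n / 2 + d * (2 * (t * s)) * (2 * s) := by
    rw [← hhalf]
    nlinarith [norm_nonneg (mask Y), norm_nonneg (mask Y')]
  rw [hsucc, div_le_iff₀ (by positivity)]
  refine h4.trans (le_of_eq ?_)
  rw [← hs2]
  ring

end Parity

/-! ### Choice of the truncation level -/

theorem two_mul_three_pow_le_eight_pow {d : ℕ} (hd : 1 ≤ d) : (2 * 3 ^ d : ℝ) ≤ 8 ^ d := by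
  calc (2 * 3 ^ d : ℝ) ≤ 2 ^ d * 3 ^ d := by
        gcongr
        exact le_self_pow₀ (by norm_num) (by lia)
    _ = 6 ^ d := by rw [← mul_pow]; norm_num
    _ ≤ 8 ^ d := by gcongr; norm_num

/-- The error of truncation at `m + 1 = ⌊n / (3 ^ d - 1)⌋` in terms of `t = n ^ (1 / d)`. -/
theorem exists_truncation_level {n d : ℕ} (hd : 1 ≤ d) {t : ℝ} (ht : 21 ≤ t)
    (hn : t ^ d = n) : ∃ m : ℕ, m * 3 ^ d + 1 < n + m ∧
      (n / ((m + 1 : ℕ) : ℝ) / 2 ^ (m + 1) : ℝ) ≤ 2 * 2 ^ (-(t / 3)) := by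
  set D : ℕ := 3 ^ d - 1 with hD
  have h3 : 3 ≤ 3 ^ d := le_self_pow₀ (by norm_num) (by lia)
  have hD3 : 3 ^ d = D + 1 := by lia
  have hDn : D < n := by
    have h : (3 : ℝ) ^ d ≤ n := by
      rw [← hn]
      gcongr
      linarith
    have : 3 ^ d ≤ n := by exact_mod_cast h
    lia
  obtain ⟨m, hm⟩ : ∃ m, n / D = m + 1 :=
    Nat.exists_eq_succ_of_ne_zero (Nat.div_pos hDn.le (by lia)).ne'
  have hle : (m + 1) * D ≤ n := hm ▸ Nat.div_mul_le_self n D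
  have hlt : n < (m + 2) * D := by
    have h := Nat.lt_div_mul_add (a := n) (b := D) (by lia)
    rw [hm] at h
    linarith
  refine ⟨m, by rw [hD3]; nlinarith, ?_⟩
  have hmul : n ≤ (m + 1) * (D + D) := by nlinarith
  have hcount : (n / ((m + 1 : ℕ) : ℝ) : ℝ) ≤ 2 * D := by
    rw [div_le_iff₀ (by positivity)]
    have : (n : ℝ) ≤ (m + 1) * (D + D) := by exact_mod_cast hmul
    push_cast
    linarith
  have hpow : (2 : ℝ) ^ (m + 1) = 2 ^ ((m : ℝ) + 1) := by
    rw [← Real.rpow_natCast]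
    push_cast
    rfl
  -- The general case weakens `D` to `3 ^ d`. For `d = 1` that would replace 2 by 3 and leave no
  -- room above `t / 3`, so `D = 2` is used directly.
  rcases hd.eq_or_lt with rfl | hd2
  · have hD2 : D = 2 := by simp [hD]
    rw [pow_one] at hn
    have hmn : (n : ℝ) ≤ 2 * (m + 1) + 1 := by
      have : n ≤ 2 * (m + 1) + 1 := by lia
      exact_mod_cast this
    have hm9 : (9 : ℝ) ≤ m := by linarith
    have hcount' : (n / ((m + 1 : ℕ) : ℝ) : ℝ) ≤ 4 := by
      refine hcount.trans ?_
      rw [hD2]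
      norm_num
    rw [div_le_iff₀ (by positivity), hpow, mul_assoc, ← Real.rpow_add (by norm_num)]
    refine hcount'.trans ?_
    have h1 : (1 : ℝ) ≤ -(t / 3) + (m + 1) := by linarith
    have h2 : (2 : ℝ) ^ (1 : ℝ) ≤ 2 ^ (-(t / 3) + ((m : ℝ) + 1)) :=
      Real.rpow_le_rpow_of_exponent_le (by norm_num) h1
    rw [Real.rpow_one] at h2
    linarith
  · have hDR : (D : ℝ) + 1 = 3 ^ d := by exact_mod_cast hD3.symm
    have hm1 : (t / 3) ^ d ≤ m + 2 := by
      rw [div_pow, hn, div_le_iff₀ (by positivity), ← hDR]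
      have : (n : ℝ) ≤ (m + 2) * D := by exact_mod_cast hlt.le
      nlinarith
    obtain ⟨e, rfl⟩ : ∃ e, d = e + 1 := ⟨d - 1, by lia⟩
    have hu : (7 : ℝ) ≤ t / 3 := by linarith
    have he : (1 : ℝ) ≤ e := by
      have : 1 ≤ e := by lia
      exact_mod_cast this
    have hbern : 1 + (e : ℝ) * 6 ≤ (t / 3) ^ e := by
      have h := one_add_mul_le_pow (a := t / 3 - 1) (by linarith) e
      rw [add_sub_cancel] at h
      nlinarith
    -- An exponent of `3 * d` suffices, since `8 ^ d` absorbs the factor `n / (m + 1) ≤ 2 * D`.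
    -- Bernoulli with `t / 3 ≥ 7` supplies it.
    have hexp : 3 * ((e + 1 : ℕ) : ℝ) ≤ -(t / 3) + ((m : ℝ) + 1) := by
      have h1 : (t / 3) * (1 + e * 6) ≤ (t / 3) ^ (e + 1) := by
        rw [pow_succ, mul_comm]
        gcongr
      push_cast
      nlinarith
    rw [div_le_iff₀ (by positivity), hpow, mul_assoc, ← Real.rpow_add (by norm_num)]
    refine hcount.trans ?_
    have h2 : (2 : ℝ) ^ (3 * ((e + 1 : ℕ) : ℝ)) ≤ 2 ^ (-(t / 3) + ((m : ℝ) + 1)) :=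
      Real.rpow_le_rpow_of_exponent_le (by norm_num) hexp
    have h8 : (2 : ℝ) ^ (3 * ((e + 1 : ℕ) : ℝ)) = 8 ^ (e + 1) := by
      rw [Real.rpow_mul (by norm_num), Real.rpow_natCast]
      norm_num
    rw [h8] at h2
    have h9 := two_mul_three_pow_le_eight_pow hd
    have h10 : (0 : ℝ) < 3 ^ (e + 1) := by positivity
    linarith

theorem OneDQACWithInput.successProb_le_one {n N d : ℕ} (I : OneDQACWithInput n N d)
    (f : (Fin n → Bool) → Bool) : I.successProb f ≤ 1 := by
  unfold successProb
  rw [div_le_one (by positivity)]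
  calc ∑ x, I.outcomeProb x (f x) ≤ ∑ _x : Fin n → Bool, (1 : ℝ) := by
        refine Finset.sum_le_sum fun x _ => ?_
        rw [← I.sum_norm_sq_initialState x]
        refine le_trans (Finset.sum_le_sum fun b _ => ?_) (sum_norm_sq_unitary_mul
          I.circuit.toMatrix_mem_unitaryGroup I.initialMatrix x).le
        split_ifs
        · exact le_rfl
        · positivity
    _ = 2 ^ n := by simp

theorem OneDQACWithInput.successProb_parity_le_rpow {n N d : ℕ} (hd : 1 ≤ d)
    (I : OneDQACWithInput n N d) :
    I.successProb (parityFn n)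
      ≤ 1 / 2 + 4 * √2 * d * (2 : ℝ) ^ (-((n : ℝ) ^ (1 / (d : ℝ)) / 6)) := by
  set t : ℝ := (n : ℝ) ^ (1 / (d : ℝ)) with ht
  have hd1 : (1 : ℝ) ≤ d := by exact_mod_cast hd
  rcases le_or_gt 21 t with h | h
  · have htn : t ^ d = n := by
      rw [ht, one_div, Real.rpow_inv_natCast_pow (by positivity) (by lia)]
    obtain ⟨m, hm, hbound⟩ := exists_truncation_level hd h htn
    refine (I.successProb_parity_le hm).trans ?_
    have hsq : √(2 * (2 : ℝ) ^ (-(t / 3))) = √2 * 2 ^ (-(t / 6)) := by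
      rw [Real.sqrt_mul (by norm_num), Real.sqrt_eq_rpow (2 ^ _), ← Real.rpow_mul (by norm_num)]
      congr 2
      ring
    have := Real.sqrt_le_sqrt hbound
    rw [hsq] at this
    have h4 : 4 * (d : ℝ) * √(n / ((m + 1 : ℕ) : ℝ) / 2 ^ (m + 1))
        ≤ 4 * d * (√2 * 2 ^ (-(t / 6))) := by gcongr
    linarith
  -- Below 21 the bound is trivial: already at `t = 21` and `d = 1` the error term is `4 * √2 * 2 ^
  -- (-7 / 2) = 1 / 2`.
  · refine (I.successProb_le_one _).trans ?_
    have h1 : (2 : ℝ) ^ (-(7 / 2) : ℝ) ≤ 2 ^ (-(t / 6)) :=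
      Real.rpow_le_rpow_of_exponent_le (by norm_num) (by linarith)
    have h2 : (2 : ℝ) ^ (-(7 / 2) : ℝ) = √2 / 16 := by
      rw [Real.sqrt_eq_rpow, show (16 : ℝ) = 2 ^ (4 : ℝ) by norm_num,
        ← Real.rpow_sub (by norm_num)]
      norm_num
    rw [h2] at h1
    have h3 : √2 * √2 = (2 : ℝ) := Real.mul_self_sqrt (by norm_num)
    have h4 : √2 * (√2 / 16) ≤ √2 * (2 : ℝ) ^ (-(t / 6)) := by gcongr
    have h5 : √2 * (2 : ℝ) ^ (-(t / 6)) ≤ d * (√2 * (2 : ℝ) ^ (-(t / 6))) :=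
      le_mul_of_one_le_left (by positivity) hd1
    linarith

/-! ### The depth lower bound -/

/-- Here `ℓ` stands for `log n`, and `1 / 6` is the gap between `2 / 3` and `1 / 2`. Once `ℓ ≥ 6 /
log 2`, the power of 2 is at most `exp (-ℓ)`. -/
theorem eventually_rpow_error_lt :
    ∀ᶠ ℓ : ℝ in Filter.atTop, 4 * √2 * ℓ * (2 : ℝ) ^ (-(ℓ ^ 2 / 6)) < 1 / 6 := by
  have hlog : 0 < Real.log 2 := Real.log_pos (by norm_num)
  have h := (Real.tendsto_pow_mul_exp_neg_atTop_nhds_zero 1).const_mul (4 * √2)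
  rw [mul_zero] at h
  filter_upwards [h.eventually_lt_const (show (0 : ℝ) < 1 / 6 by norm_num),
    Filter.eventually_ge_atTop (6 / Real.log 2)] with ℓ h1 h2
  refine lt_of_le_of_lt ?_ h1
  have hℓ : 0 ≤ ℓ := le_trans (by positivity) h2
  rw [pow_one, mul_assoc]
  gcongr
  rw [Real.rpow_def_of_pos (by norm_num), Real.exp_le_exp]
  rw [div_le_iff₀ hlog] at h2
  nlinarith

/-- After taking logarithms this reads `2 * log (log n) ≤ log n / d`, which is where the constant `1
/ 2` comes from. -/
theorem sq_log_le_rpow {n d : ℕ} (hd : 1 ≤ d) (hn : 1 < Real.log (n : ℝ))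
    (h : (d : ℝ) < 1 / 2 * (Real.log n / Real.log (Real.log n))) :
    Real.log (n : ℝ) ^ 2 ≤ (n : ℝ) ^ (1 / (d : ℝ)) := by
  have hd0 : (0 : ℝ) < d := by exact_mod_cast hd
  have hll : 0 < Real.log (Real.log n) := Real.log_pos hn
  have hn0 : (0 : ℝ) < n := by
    rcases Nat.eq_zero_or_pos n with rfl | h0
    · norm_num at hn
    · exact_mod_cast h0
  rw [← Real.log_le_log_iff (by positivity) (by positivity), Real.log_pow, Real.log_rpow hn0,
    one_div, inv_mul_eq_div, le_div_iff₀ hd0]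
  rw [← mul_div_assoc, lt_div_iff₀ hll] at h
  push_cast
  nlinarith

theorem mainTheorem2 :
    (∀ n d N : ℕ, 1 ≤ n → 1 ≤ d → ∀ C : OneDQACWithInput n N d,
      C.successProb (parityFn n) ≤
        1 / 2 + 4 * Real.sqrt 2 * (d : ℝ) *
          (2 : ℝ) ^ (-((n : ℝ) ^ (1 / (d : ℝ)) / 6))) ∧
    (∃ c : ℝ, 0 < c ∧ ∃ n₀ : ℕ, ∀ n : ℕ, n₀ ≤ n → ∀ (d N : ℕ) (C : OneDQACWithInput n N d),
      2 / 3 ≤ C.successProb (parityFn n) →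
        c * (Real.log (n : ℝ) / Real.log (Real.log (n : ℝ))) ≤ (d : ℝ)) := by
  refine ⟨fun n d N _ hd C => C.successProb_parity_le_rpow hd, 1 / 2, by norm_num, ?_⟩
  have hlog : Filter.Tendsto (fun n : ℕ => Real.log (n : ℝ)) Filter.atTop Filter.atTop :=
    Real.tendsto_log_atTop.comp tendsto_natCast_atTop_atTop
  obtain ⟨n₀, hn₀⟩ := Filter.eventually_atTop.mp
    (((hlog.eventually eventually_rpow_error_lt).and
      (hlog.eventually_ge_atTop (Real.exp 1))).and (Filter.eventually_ge_atTop 2))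
  refine ⟨n₀, fun n hn d N C hC => ?_⟩
  obtain ⟨⟨herr, hexp⟩, hn2⟩ := hn₀ n hn
  by_contra! hlt
  have hl1 : 1 < Real.log (n : ℝ) := lt_of_lt_of_le (by simp) hexp
  have hll : 1 ≤ Real.log (Real.log n) := (Real.le_log_iff_exp_le (by linarith)).mpr hexp
  rcases Nat.eq_zero_or_pos d with rfl | hd
  -- At depth 0 the exponent `1 / d` is meaningless, so the bound before optimization is used: its
  -- error term carries the factor `d = 0`, and with `m = 0` it only needs `n ≥ 2`.
  · have h := C.successProb_parity_le (m := 0) (by lia)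
    norm_num at h
    linarith
  · have hsq := sq_log_le_rpow hd hl1 hlt
    have hdl : (d : ℝ) ≤ Real.log n := by
      have : Real.log (n : ℝ) / Real.log (Real.log n) ≤ Real.log n :=
        div_le_self (by linarith) hll
      linarith
    have h := C.successProb_parity_le_rpow hd
    have hpow : (2 : ℝ) ^ (-((n : ℝ) ^ (1 / (d : ℝ)) / 6)) ≤ 2 ^ (-(Real.log (n : ℝ) ^ 2 / 6)) :=
      Real.rpow_le_rpow_of_exponent_le (by norm_num) (by linarith)
    have hle : 4 * √2 * (d : ℝ) * (2 : ℝ) ^ (-((n : ℝ) ^ (1 / (d : ℝ)) / 6))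
        ≤ 4 * √2 * Real.log n * 2 ^ (-(Real.log (n : ℝ) ^ 2 / 6)) := by gcongr
    linarith
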